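/- Let $G$ be a finitely generated group acting by homeomorphisms on an infinite compact metric space $(X,d)$. Suppose that the action is pointwise periodic, i.e. for every $x\in X$ the orbit $Gx=\{gx : g\in G\}$ is finite. Then the action is not expansive; that is, there is no constant $c>0$ such that $\sup_{g\in G} d(gx,gy)>c$ for all distinct $x,y\in X$. -/

import Mathlib

/-- An action of `G` on a metric space `X` is expansive if there is a constant `c > 0` such that
`sup_{g ∈ G} d(g x, g y) > c` for all distinct `x, y ∈ X`. The supremum is a real supremum; when
`X` is compact the distances are bounded, so it is a genuine least upper bound. -/
def IsExpansiveAction (G X : Type*) [Group G] [MetricSpace X] [MulAction G X] : Prop :=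
  ∃ c : ℝ, 0 < c ∧ ∀ x y : X, x ≠ y → c < ⨆ g : G, dist (g • x) (g • y)

/-- An action is pointwise periodic if each of its orbits is finite. -/
def IsPointwisePeriodicAction (G X : Type*) [Group G] [MulAction G X] : Prop :=
  ∀ x : X, (MulAction.orbit G x).Finite

/-!
Assume the action is expansive. Expansivity passes to finite-index subgroups `H`, since finitely
many coset representatives act equicontinuously (`IsExpansiveAction.subgroup`), and the points fixed
by an expansive action are uniformly separated, hence finite in number
(`IsExpansiveAction.finite_fixedPoints`). Every point is fixed by its stabilizer, which has finite
index and is therefore finitely generated; as a finitely generated group has only countably many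
finitely generated subgroups, `X` is countable.

An infinite compact space has a nonisolated point, and by Baire's theorem a nonempty closed
countable set has an isolated point, so some nonisolated point `x` of `X` has a neighbourhood in
which all other points are isolated in `X`. The stabilizer `H` of `x` is finitely generated, and near
such a point this forces whole `H`-orbits to remain in any prescribed neighbourhood of `x`
(`exists_orbit_subset_of_mem_nhds`): outside a smaller neighbourhood of `x` there are only finitely
many points that a generator can move out, and by periodicity only finitely many points have an
orbit meeting this finite set. An orbit staying too close to `x` contradicts the expansivity of `H`.
-/

open Set Filter Topology Uniformity

/-! ### Expansive actions on compact spaces -/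

section Expansive

variable {G X : Type*} [Group G] [MetricSpace X] [CompactSpace X] [MulAction G X]

theorem bddAbove_range_dist_smul (x y : X) :
    BddAbove (range fun g : G => dist (g • x) (g • y)) :=
  ⟨Metric.diam (univ : Set X), by
    rintro _ ⟨g, rfl⟩
    exact Metric.dist_le_diam_of_mem (isCompact_univ).isBounded (mem_univ _) (mem_univ _)⟩

theorem IsExpansiveAction.subgroup [ContinuousConstSMul G X] (h : IsExpansiveAction G X)
    (H : Subgroup G) [H.FiniteIndex] : IsExpansiveAction H X := by
  obtain ⟨c, hc, hexp⟩ := h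
  have hunif : ∀ᶠ p : X × X in 𝓤 X, ∀ q : G ⧸ H, dist (q.out • p.1) (q.out • p.2) < c :=
    eventually_all.2 fun q =>
      (CompactSpace.uniformContinuous_of_continuous (continuous_const_smul q.out))
        (Metric.dist_mem_uniformity hc)
  obtain ⟨δ, hδ, hδc⟩ := Metric.mem_uniformity_dist.1 hunif
  refine ⟨δ / 2, half_pos hδ, fun x y hxy => ?_⟩
  by_contra! hle
  refine (hexp x y hxy).not_ge (ciSup_le fun g => ?_)
  -- Write `g` as a coset representative times an element of `H`.
  obtain ⟨k, hk⟩ := QuotientGroup.mk_out_eq_mul H g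
  have hg : g = (g : G ⧸ H).out * ((k⁻¹ : H) : G) := by simp [hk]
  have hclose : dist (k⁻¹ • x) (k⁻¹ • y) < δ :=
    ((le_ciSup (bddAbove_range_dist_smul x y) k⁻¹).trans hle).trans_lt (half_lt_self hδ)
  have := hδc hclose (g : G ⧸ H)
  rw [hg, mul_smul, mul_smul]
  exact this.le

theorem IsExpansiveAction.finite_fixedPoints [ContinuousConstSMul G X]
    (h : IsExpansiveAction G X) : (MulAction.fixedPoints G X).Finite := by
  obtain ⟨c, hc, hexp⟩ := h
  have hclosed : IsClosed (MulAction.fixedPoints G X) := by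
    simp only [MulAction.fixedPoints, ofPred_forall]
    exact isClosed_iInter fun g => isClosed_eq (continuous_const_smul g) continuous_id
  refine hclosed.isCompact.finite (isDiscrete_iff_forall_mem_exists_isOpen.2 fun y hy =>
    ⟨Metric.ball y c, Metric.isOpen_ball, ?_⟩)
  refine subset_antisymm (fun z hz => ?_) (by simpa [hc] using hy)
  by_contra hne
  have hlt := hexp z y hne
  simp only [hy _, hz.2 _, ciSup_const] at hlt
  exact hlt.not_gt hz.1

end Expansive

/-! ### Finite-index subgroups and periodic points -/

theorem Group.FG.countable (G : Type*) [Group G] [Group.FG G] : Countable G := by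
  obtain ⟨S, hS, φ, hφ⟩ := Monoid.fg_iff_exists_freeMonoid_hom_surjective.1
    (inferInstance : Monoid.FG G)
  have := hS.countable.to_subtype
  have : Countable (FreeMonoid S) := inferInstanceAs (Countable (List S))
  exact hφ.countable

theorem Group.FG.countable_finiteIndex (G : Type*) [Group G] [Group.FG G] :
    {H : Subgroup G | H.FiniteIndex}.Countable := by
  have := Group.FG.countable G
  refine (countable_range fun S : Finset G => Subgroup.closure (S : Set G)).mono fun H hH => ?_
  have : H.FiniteIndex := hH
  exact (Group.fg_iff_subgroup_fg H).1 inferInstance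

section Periodic

variable {G X : Type*} [Group G] [MulAction G X]

theorem IsPointwisePeriodicAction.finiteIndex_stabilizer (h : IsPointwisePeriodicAction G X)
    (x : X) : (MulAction.stabilizer G x).FiniteIndex := by
  refine ⟨?_⟩
  rw [MulAction.index_stabilizer]
  exact ((ncard_pos (h x)).2 (MulAction.nonempty_orbit x)).ne'

theorem IsPointwisePeriodicAction.subgroup (h : IsPointwisePeriodicAction G X)
    (H : Subgroup G) : IsPointwisePeriodicAction H X := fun x =>
  (h x).subset <| by
    rintro _ ⟨k, rfl⟩
    exact ⟨k, rfl⟩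

theorem IsExpansiveAction.countable_of_isPointwisePeriodicAction {G X : Type*} [Group G]
    [Group.FG G] [MetricSpace X] [CompactSpace X] [MulAction G X] [ContinuousConstSMul G X]
    (hexp : IsExpansiveAction G X) (hper : IsPointwisePeriodicAction G X) : Countable X := by
  rw [← countable_univ_iff]
  refine ((Group.FG.countable_finiteIndex G).biUnion
    (t := fun (H : Subgroup G) _ => MulAction.fixedPoints H X) fun H hH => ?_).mono fun x _ => ?_
  · have : H.FiniteIndex := hH
    have : ContinuousConstSMul H X := ⟨fun k => continuous_const_smul (k : G)⟩
    exact (hexp.subgroup H).finite_fixedPoints.countable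
  · exact mem_biUnion (hper.finiteIndex_stabilizer x) fun k => k.2

end Periodic

/-! ### Isolated points -/

/-- A nonisolated point of rank one in the sense of Cantor–Bendixson exists: the set of nonisolated
points is closed, nonempty and countable, so Baire's theorem gives it an isolated point. -/
theorem exists_nhds_forall_ne_isOpen_singleton (X : Type*) [TopologicalSpace X] [T2Space X]
    [CompactSpace X] [Countable X] [Infinite X] :
    ∃ x : X, ¬ IsOpen {x} ∧ ∃ U ∈ 𝓝 x, ∀ y ∈ U, y ≠ x → IsOpen {y} := by
  set D : Set X := {x | ¬ IsOpen {x}} with hD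
  have hDclosed : IsClosed D := by
    rw [← isOpen_compl_iff]
    have : Dᶜ = ⋃ x ∈ Dᶜ, {x} := (biUnion_of_singleton _).symm
    rw [this]
    exact isOpen_biUnion fun x hx => not_not.1 hx
  have hDne : D.Nonempty := by
    by_contra! hempty
    have : DiscreteTopology X := discreteTopology_iff_isOpen_singleton.2 fun x => by
      by_contra hx
      exact (hempty ▸ (show x ∈ D from hx) : x ∈ (∅ : Set X))
    exact not_finite_iff_infinite.2 ‹Infinite X› finite_of_compact_of_discrete
  have := hDne.to_subtype
  have : CompactSpace D := isCompact_iff_compactSpace.1 hDclosed.isCompact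
  obtain ⟨x, hx⟩ := nonempty_interior_of_iUnion_of_closed
    (f := fun x : D => {x}) (fun _ => isClosed_singleton) (iUnion_of_singleton D)
  have hxopen : ({x} : Set D) ∈ 𝓝 x := by
    obtain ⟨y, hy⟩ := hx
    have hyx : y = x := mem_singleton_iff.1 (interior_subset hy)
    exact mem_interior_iff_mem_nhds.1 (hyx ▸ hy)
  obtain ⟨U, hU, hUx⟩ := mem_nhds_induced _ _ _ |>.1 hxopen
  refine ⟨x, x.2, U, hU, fun y hy hne => ?_⟩
  by_contra hyD
  exact hne (congrArg Subtype.val (hUx (show (⟨y, hyD⟩ : D) ∈ _ from hy)))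

/-- Finite generation enters here: each of the finitely many generators moves only finitely many
points out of a small compact neighbourhood `C` of `x`, and by periodicity only finitely many orbits
contain such a point; every other orbit that meets `C` lies in `C`. -/
theorem exists_orbit_subset_of_mem_nhds {G X : Type*} [Group G] [Group.FG G] [TopologicalSpace X]
    [T2Space X] [CompactSpace X] [MulAction G X] [ContinuousConstSMul G X]
    (hper : IsPointwisePeriodicAction G X) {x : X} (hfix : x ∈ MulAction.fixedPoints G X)
    (hx : ¬ IsOpen {x}) {U : Set X} (hU : U ∈ 𝓝 x) (hiso : ∀ y ∈ U, y ≠ x → IsOpen {y})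
    {W : Set X} (hW : W ∈ 𝓝 x) : ∃ y, y ≠ x ∧ MulAction.orbit G y ⊆ W := by
  obtain ⟨S, hS, hSfin⟩ := (Monoid.fg_iff (M := G)).1 inferInstance
  obtain ⟨C, hC, hCsub, hCcompact⟩ := local_compact_nhds (inter_mem hU hW)
  -- `V` is the set of points that no generator moves out of `C`.
  set V : Set X := ⋂ s ∈ S, (s • ·) ⁻¹' C
  have hV : V ∈ 𝓝 x := (biInter_mem hSfin).2 fun s _ =>
    (continuous_const_smul s).continuousAt.preimage_mem_nhds (by simpa [hfix s] using hC)
  have hKfin : (C \ interior V).Finite := by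
    refine (hCcompact.diff isOpen_interior).finite
      (isDiscrete_iff_forall_mem_exists_isOpen.2 fun y hy => ⟨{y}, ?_, ?_⟩)
    · refine hiso y (hCsub hy.1).1 ?_
      rintro rfl
      exact hy.2 (mem_interior_iff_mem_nhds.2 hV)
    · simpa using hy
  have hBfin : (⋃ z ∈ C \ interior V, MulAction.orbit G z).Finite :=
    hKfin.biUnion fun z _ => hper z
  have : (𝓝[≠] x).NeBot := by
    rwa [neBot_iff, Ne, ← isOpen_singleton_iff_punctured_nhds]
  obtain ⟨y, ⟨hyC, hyB⟩, hyx⟩ : ∃ y, y ∈ C \ _ ∧ y ≠ x := by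
    obtain ⟨y, hy, hyB⟩ :=
      ((infinite_of_mem_nhds x hC).sdiff (hBfin.union (finite_singleton x))).nonempty
    exact ⟨y, ⟨hy, fun h => hyB (Or.inl h)⟩, fun h => hyB (Or.inr h)⟩
  refine ⟨y, hyx, ?_⟩
  have hstep : ∀ z ∈ MulAction.orbit G y, z ∈ C → z ∈ V := by
    intro z hz hzC
    by_contra hzV
    refine hyB (mem_biUnion ⟨hzC, fun h => hzV (interior_subset h)⟩ ?_)
    exact MulAction.mem_orbit_symm.1 hz
  have hstay : ∀ g : G, g • y ∈ C := by
    intro g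
    have hg : g ∈ Submonoid.closure S := hS ▸ Submonoid.mem_top g
    induction hg using Submonoid.closure_induction_left with
    | one => simpa using hyC
    | mul_left s hs g _ ih =>
      rw [mul_smul]
      exact mem_iInter₂.1 (hstep _ (MulAction.mem_orbit y g) ih) s hs
  rintro _ ⟨g, rfl⟩
  exact (hCsub (hstay g)).2

/-! ### Nonexpansivity -/

theorem mainTheorem3 {G X : Type*} [Group G] [Group.FG G] [MetricSpace X] [CompactSpace X]
    [MulAction G X] [ContinuousConstSMul G X] [Infinite X]
    (hper : IsPointwisePeriodicAction G X) :
    ¬ IsExpansiveAction G X := by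
  intro hexp
  have := hexp.countable_of_isPointwisePeriodicAction hper
  obtain ⟨x, hx, U, hU, hiso⟩ := exists_nhds_forall_ne_isOpen_singleton X
  let H := MulAction.stabilizer G x
  have : H.FiniteIndex := hper.finiteIndex_stabilizer x
  have : ContinuousConstSMul H X := ⟨fun k => continuous_const_smul (k : G)⟩
  have hfix : x ∈ MulAction.fixedPoints H X := fun k => k.2
  obtain ⟨c, hc, hcexp⟩ := hexp.subgroup H
  obtain ⟨y, hyx, hy⟩ := exists_orbit_subset_of_mem_nhds (hper.subgroup H) hfix hx hU hiso
    (Metric.ball_mem_nhds x hc)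
  refine (hcexp y x hyx).not_ge (ciSup_le fun k => ?_)
  rw [hfix k]
  exact (Metric.mem_ball.1 (hy (MulAction.mem_orbit y k))).le
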